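/- Let $M$ be a non-empty paracompact Hausdorff smooth manifold of dimension $n\ge 2$, with slit tangent bundle $\mathcal TM=TM\setminus\{0\}$ and projection $\pi$. Write $\gamma$ for the vertical lift, $\rho$ for the map $W\mapsto d\pi(W)$ to the pullback bundle, $J=\gamma\circ\rho$, $\overline\eta(u)=u$ and $\mathcal C=\gamma\overline\eta$. Let $F:TM\to[0,\infty)$ be a Finsler structure: continuous on $TM$, smooth on $\mathcal TM$, positively homogeneous of degree $1$ on the fibres, and such that $dd_JE$, $E=\tfrac12F^2$, has maximal rank on $\mathcal TM$. Let $g(\rho W,\rho Z)=dd_JE(JW,Z)$ be its metric tensor and $G$ its geodesic spray, i.e. the spray with $i_G\,dd_JE=-dE$. Let $\overline\varphi$ be a concurrent $\pi$-vector field of $F$, that is, a nowhere vanishing smooth section of the pullback of $TM$ to $\mathcal TM$ such that, for all sections $\overline W$, $$\nabla_{\beta\overline W}\overline\varphi=-\overline W=D^\circ_{\beta\overline W}\overline\varphi,\qquad \nabla_{\gamma\overline W}\overline\varphi=0=D^\circ_{\gamma\overline W}\overline\varphi,$$ where $\nabla$ and $D^\circ$ are the Cartan and Berwald connections of $F$ and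 $\beta$ is the horizontal lift of the Barthel connection $[J,G]$. Put $\Phi=g(\overline\varphi,\overline\eta)$, $\mathcal D=\{u\in\mathcal TM: F(u)>\Phi(u)\}$ and $$\widehat F=\frac{F^2}{F-\Phi}\quad\text{on }\mathcal D ,$$ and assume that $\widehat F$ is a conic pseudo-Finsler structure on $M$ with conic domain $\mathcal D$: that is, $\mathcal D$ is a non-empty open subset of $\mathcal TM$, invariant under multiplication by positive scalars, with $\pi(\mathcal D)=M$ and connected fibres, and $\widehat F$ is smooth, non-negative and positively homogeneous of degree $1$ on $\mathcal D$, with $dd_J(\tfrac12\widehat F^2)$ of maximal rank on $\mathcal D$. Let $\widehat G$ be the geodesic spray of $\widehat F$ on $\mathcal D$. Then $G$ and $\widehat G$ are not projectively related on $\mathcal D$: there is no function $A:\mathcal D\to\mathbb R$, positively homogeneous of degree $1$ on the fibres, such that $\widehat G=G-2A\,\mathcal C$ on $\mathcal D$. -/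

import Mathlib

open scoped Manifold ContDiff

noncomputable section

/-!
Conventions. `M` is an `n`-dimensional smooth manifold, `TangentBundle (𝓡 n) M` its tangent
bundle, and a point `u` of it is a pair of `u.proj : M` and `u.2 : T_{u.proj} M`.
Tensorial objects on the tangent bundle are written in natural (bundle) charts
`(x, y)` with values in `ℝⁿ × ℝⁿ`, and each equation is imposed in every such chart.
-/

/-- The coordinate space `ℝⁿ`, which is also the typical fibre of the pullback bundle. -/
abbrev Vec (n : ℕ) : Type := EuclideanSpace ℝ (Fin n)

/-- The coordinate space of the tangent bundle; tangent vectors of the tangent bundle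
also have coordinates in it. -/
abbrev Phase (n : ℕ) : Type := Vec n × Vec n

/-! ### Calculus on the tangent bundle in a natural chart -/

namespace Local

variable {n : ℕ}

/-- The natural injection `γ` of the pullback bundle as the vertical bundle: `v ↦ (0, v)`. -/
def gam : Vec n →L[ℝ] Phase n := ContinuousLinearMap.inr ℝ (Vec n) (Vec n)

/-- The bundle map `ρ` from the tangent spaces of `TM` to the pullback bundle. -/
def rho : Phase n →L[ℝ] Vec n := ContinuousLinearMap.fst ℝ (Vec n) (Vec n)

/-- The vertical endomorphism `J = γ ∘ ρ`. -/
def vertJ : Phase n →L[ℝ] Phase n := gam.comp rho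

/-- The Liouville vector field `C = γ η̄`, where `η̄ (x, y) = y`. -/
def liouville (p : Phase n) : Phase n := gam p.2

/-- The `1`-form `d_J e = de ∘ J` of a function `e`. -/
def dJ (e : Phase n → ℝ) (p : Phase n) : Phase n →L[ℝ] ℝ := (fderiv ℝ e p).comp vertJ

/-- The `2`-form `d d_J e`, evaluated on two tangent vectors at `p`. -/
def ddJ (e : Phase n → ℝ) (p W Z : Phase n) : ℝ :=
  fderiv ℝ (dJ e) p W Z - fderiv ℝ (dJ e) p Z W

/-- The metric tensor of the energy `e`: `g (ρ W, ρ Z) = d d_J e (J W, Z)`. -/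
def metric (e : Phase n → ℝ) (p : Phase n) (v w : Vec n) : ℝ :=
  ddJ e p (gam v) (w, 0)

/-- `d d_J e` has maximal rank at `p`. -/
def MaxRank (e : Phase n → ℝ) (p : Phase n) : Prop :=
  ∀ W : Phase n, (∀ Z : Phase n, ddJ e p W Z = 0) → W = 0

/-- `G` is a spray on `Ω`: a smooth vector field with `J G = C` and `[C, G] = G`. -/
def IsSpray (Ω : Set (Phase n)) (G : Phase n → Phase n) : Prop :=
  ContDiffOn ℝ ∞ G Ω ∧
    ∀ p ∈ Ω, vertJ (G p) = liouville p ∧ VectorField.lieBracket ℝ liouville G p = G p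

/-- `G` is a geodesic spray of the energy `e` on `Ω`: a spray with `i_G d d_J e = - de`. -/
def IsGeodesicSpray (Ω : Set (Phase n)) (e : Phase n → ℝ) (G : Phase n → Phase n) : Prop :=
  IsSpray Ω G ∧ ∀ p ∈ Ω, ∀ Z : Phase n, ddJ e p (G p) Z = - fderiv ℝ e p Z

/-- The Barthel connection `Γ = [J, G]`, that is `Γ W = [J W, G] - J [W, G]`; it is tensorial
in `W`, so the vector `W` is extended with constant coordinates. -/
def barthel (G : Phase n → Phase n) (p W : Phase n) : Phase n :=
  VectorField.lieBracket ℝ (fun _ => vertJ W) G p -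
    vertJ (VectorField.lieBracket ℝ (fun _ => W) G p)

/-- The horizontal projector `h = (I + Γ) / 2`. -/
def horProj (G : Phase n → Phase n) (p W : Phase n) : Phase n :=
  (1 / 2 : ℝ) • (W + barthel G p W)

/-- The vertical projector `v = (I - Γ) / 2`. -/
def verProj (G : Phase n → Phase n) (p W : Phase n) : Phase n :=
  (1 / 2 : ℝ) • (W - barthel G p W)

/-- The vertical lift `γ X̄` of a `π`-vector field, as a vector field. -/
def gamF (X : Phase n → Vec n) : Phase n → Phase n := fun p => gam (X p)

/-- The horizontal lift `β X̄` of a `π`-vector field, as a vector field: `h` applied to any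
vector field that `ρ` maps to `X̄`. -/
def betaF (G : Phase n → Phase n) (X : Phase n → Vec n) : Phase n → Phase n :=
  fun p => horProj G p (X p, 0)

/-- `D°_{γ X̄} Ȳ = ρ [γ X̄, β Ȳ]` for the Berwald connection `D°`. -/
def berwaldVer (G : Phase n → Phase n) (X Y : Phase n → Vec n) (p : Phase n) : Vec n :=
  rho (VectorField.lieBracket ℝ (gamF X) (betaF G Y) p)

/-- `D°_{β X̄} Ȳ` for the Berwald connection `D°`, given by `γ D°_{β X̄} Ȳ = v [β X̄, γ Ȳ]`;
the right-hand side is vertical and `γ⁻¹` is its second component. -/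
def berwaldHor (G : Phase n → Phase n) (X Y : Phase n → Vec n) (p : Phase n) : Vec n :=
  (verProj G p (VectorField.lieBracket ℝ (betaF G X) (gamF Y) p)).2

/-- The function `g (X̄, Ȳ)`. -/
def metricF (e : Phase n → ℝ) (X Y : Phase n → Vec n) : Phase n → ℝ :=
  fun p => metric e p (X p) (Y p)

/-- The derivative `W · f` of a function along a vector field. -/
def along (W : Phase n → Phase n) (f : Phase n → ℝ) : Phase n → ℝ :=
  fun p => fderiv ℝ f p (W p)

/-- The `π`-vector field `ρ [V, W]`. -/
def rhoBr (V W : Phase n → Phase n) : Phase n → Vec n :=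
  fun p => rho (VectorField.lieBracket ℝ V W p)

/-- `∇_{γ X̄} Ȳ = V̄` on `Ω` for the Cartan connection `∇`, by the formula for
`2 g (∇_{γ X̄} Ȳ, Z̄)` that determines `∇_{γ X̄} Ȳ`. -/
def CartanVerEq (Ω : Set (Phase n)) (e : Phase n → ℝ) (G : Phase n → Phase n)
    (X Y V : Phase n → Vec n) : Prop :=
  ∀ Z : Phase n → Vec n, ContDiffOn ℝ ∞ Z Ω → ∀ p ∈ Ω,
    2 * metricF e V Z p =
      along (gamF X) (metricF e Y Z) p
        + metricF e Y (rhoBr (betaF G Z) (gamF X)) p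
        + metricF e Z (rhoBr (gamF X) (betaF G Y)) p

/-- `∇_{β X̄} Ȳ = V̄` on `Ω` for the Cartan connection `∇`, by the formula for
`2 g (∇_{β X̄} Ȳ, Z̄)` that determines `∇_{β X̄} Ȳ`. -/
def CartanHorEq (Ω : Set (Phase n)) (e : Phase n → ℝ) (G : Phase n → Phase n)
    (X Y V : Phase n → Vec n) : Prop :=
  ∀ Z : Phase n → Vec n, ContDiffOn ℝ ∞ Z Ω → ∀ p ∈ Ω,
    2 * metricF e V Z p =
      along (betaF G X) (metricF e Y Z) p
        + along (betaF G Y) (metricF e Z X) p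
        - along (betaF G Z) (metricF e X Y) p
        - metricF e X (rhoBr (betaF G Y) (betaF G Z)) p
        + metricF e Y (rhoBr (betaF G Z) (betaF G X)) p
        + metricF e Z (rhoBr (betaF G X) (betaF G Y)) p

/-- `∇_{β W̄} φ̄ = - W̄ = D°_{β W̄} φ̄` and `∇_{γ W̄} φ̄ = 0 = D°_{γ W̄} φ̄` on `Ω`, for all
smooth `W̄`, where `e` is the energy and `G` its geodesic spray. -/
def IsConcurrent (Ω : Set (Phase n)) (e : Phase n → ℝ) (G : Phase n → Phase n)
    (φ : Phase n → Vec n) : Prop :=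
  ∀ W : Phase n → Vec n, ContDiffOn ℝ ∞ W Ω →
    CartanHorEq Ω e G W φ (fun p => - W p) ∧ CartanVerEq Ω e G W φ (fun _ => 0) ∧
      ∀ p ∈ Ω, berwaldHor G W φ p = - W p ∧ berwaldVer G W φ p = 0

end Local

/-! ### Global objects on a manifold -/

section Global

variable {n : ℕ} {M : Type*} [TopologicalSpace M] [ChartedSpace (Vec n) M]
  [IsManifold (𝓡 n) ∞ M]

/-- The slit tangent bundle. -/
def slit (n : ℕ) (M : Type*) [TopologicalSpace M] [ChartedSpace (Vec n) M]
    [IsManifold (𝓡 n) ∞ M] : Set (TangentBundle (𝓡 n) M) :=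
  {u | u.2 ≠ 0}

/-- The tangent vector `c u`. -/
def scale (c : ℝ) (u : TangentBundle (𝓡 n) M) : TangentBundle (𝓡 n) M := ⟨u.proj, c • u.2⟩

/-- The natural chart of the tangent bundle over the chart of `M` around `x`: it sends a tangent
vector to the coordinates of its base point and its components in these coordinates. -/
def natChart (x : M) : PartialEquiv (TangentBundle (𝓡 n) M) (Phase n) :=
  extChartAt (𝓡 n).tangent (⟨x, 0⟩ : TangentBundle (𝓡 n) M)

/-- The part of the subset `Ω` of the tangent bundle in the natural chart around `x`. -/
def chartDom (Ω : Set (TangentBundle (𝓡 n) M)) (x : M) : Set (Phase n) :=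
  (natChart x).target ∩ (natChart x).symm ⁻¹' Ω

/-- The energy `E = F² / 2` in the natural chart around `x`. -/
def chartEnergy (F : TangentBundle (𝓡 n) M → ℝ) (x : M) (p : Phase n) : ℝ :=
  F ((natChart x).symm p) ^ 2 / 2

/-- A `π`-vector field: it attaches to `u` a vector of `T_{u.proj} M`. Only its values on the slit
tangent bundle matter. -/
abbrev PiField (n : ℕ) (M : Type*) [TopologicalSpace M] [ChartedSpace (Vec n) M]
    [IsManifold (𝓡 n) ∞ M] : Type _ :=
  (u : TangentBundle (𝓡 n) M) → TangentSpace (𝓡 n) u.proj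

/-- A vector field on the tangent bundle. -/
abbrev TMField (n : ℕ) (M : Type*) [TopologicalSpace M] [ChartedSpace (Vec n) M]
    [IsManifold (𝓡 n) ∞ M] : Type _ :=
  (u : TangentBundle (𝓡 n) M) → TangentSpace (𝓡 n).tangent u

/-- The components of a `π`-vector field in the natural chart around `x`. -/
def chartPi (φ : PiField n M) (x : M) (p : Phase n) : Vec n :=
  (natChart x ⟨((natChart x).symm p).proj, φ ((natChart x).symm p)⟩).2

/-- The components of a vector field on the tangent bundle in the natural chart around `x`. -/
def chartField (G : TMField n M) (x : M) (p : Phase n) : Phase n :=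
  mfderiv (𝓡 n).tangent 𝓘(ℝ, Phase n) (natChart (n := n) x) ((natChart x).symm p)
    (G ((natChart x).symm p))

/-- A Finsler structure on `M`: continuous, smooth on the slit tangent bundle, nonnegative,
positively homogeneous of degree `1`, with `d d_J E` of maximal rank on the slit tangent bundle. -/
structure IsFinsler (F : TangentBundle (𝓡 n) M → ℝ) : Prop where
  nonneg : ∀ u, 0 ≤ F u
  smooth : ContMDiffOn (𝓡 n).tangent 𝓘(ℝ, ℝ) ∞ F (slit n M)
  continuous : Continuous F
  homog : ∀ u, ∀ c : ℝ, 0 < c → F (scale c u) = c * F u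
  maxRank : ∀ x : M, ∀ p ∈ chartDom (slit n M) x, Local.MaxRank (chartEnergy F x) p

/-- A conic pseudo-Finsler structure on `M` with conic domain `D`: only the values of `F` on `D`
matter. -/
structure IsConicPseudoFinsler (D : Set (TangentBundle (𝓡 n) M))
    (F : TangentBundle (𝓡 n) M → ℝ) : Prop where
  isOpen : IsOpen D
  nonempty : D.Nonempty
  subset_slit : D ⊆ slit n M
  conic : ∀ u ∈ D, ∀ c : ℝ, 0 < c → scale c u ∈ D
  surj : ∀ x : M, ∃ u ∈ D, u.proj = x
  fibre_connected : ∀ x : M, IsConnected {y : TangentSpace (𝓡 n) x |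
    (⟨x, y⟩ : TangentBundle (𝓡 n) M) ∈ D}
  nonneg : ∀ u ∈ D, 0 ≤ F u
  smooth : ContMDiffOn (𝓡 n).tangent 𝓘(ℝ, ℝ) ∞ F D
  homog : ∀ u ∈ D, ∀ c : ℝ, 0 < c → F (scale c u) = c * F u
  maxRank : ∀ x : M, ∀ p ∈ chartDom D x, Local.MaxRank (chartEnergy F x) p

/-- `G` is the geodesic spray of `F` on the open set `Ω`. -/
def IsGeodesicSpray (Ω : Set (TangentBundle (𝓡 n) M)) (F : TangentBundle (𝓡 n) M → ℝ)
    (G : TMField n M) : Prop :=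
  ∀ x : M, Local.IsGeodesicSpray (chartDom Ω x) (chartEnergy F x) (chartField G x)

/-- `φ` is a concurrent `π`-vector field of the Finsler structure `F` with geodesic spray `G`:
smooth, nowhere zero on the slit tangent bundle, and with the prescribed derivatives for the
Cartan and Berwald connections. -/
structure IsConcurrent (F : TangentBundle (𝓡 n) M → ℝ) (G : TMField n M)
    (φ : PiField n M) : Prop where
  smooth : ContMDiffOn (𝓡 n).tangent (𝓡 n).tangent ∞
    (fun u => (⟨u.proj, φ u⟩ : TangentBundle (𝓡 n) M)) (slit n M)
  ne_zero : ∀ u ∈ slit n M, φ u ≠ 0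
  concurrent : ∀ x : M, Local.IsConcurrent (chartDom (slit n M) x) (chartEnergy F x)
    (chartField G x) (chartPi φ x)

/-- The metric tensor `g_u (v, w) = ∂²/∂s∂t E (u + s v + t w)` at `s = t = 0`, `E = F² / 2`,
written without coordinates. In a natural chart it is `Local.metric`, since
`d d_J E (J V, W)` is the second derivative of `E` along the fibre in the
directions `ρ V` and `ρ W`. -/
def finslerMetric (F : TangentBundle (𝓡 n) M → ℝ) (u : TangentBundle (𝓡 n) M)
    (v w : TangentSpace (𝓡 n) u.proj) : ℝ :=
  deriv (fun s : ℝ => deriv (fun t : ℝ =>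
    F (⟨u.proj, u.2 + s • v + t • w⟩ : TangentBundle (𝓡 n) M) ^ 2 / 2) 0) 0

/-- `Φ = g (φ̄, η̄)`, where `η̄ u = u`. -/
def assocForm (F : TangentBundle (𝓡 n) M → ℝ) (φ : PiField n M)
    (u : TangentBundle (𝓡 n) M) : ℝ :=
  finslerMetric F u (φ u) u.2

/-- The conic domain `F > Φ` in the slit tangent bundle. -/
def matsumotoDomain (F : TangentBundle (𝓡 n) M → ℝ) (φ : PiField n M) :
    Set (TangentBundle (𝓡 n) M) :=
  {u | u ∈ slit n M ∧ assocForm F φ u < F u}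

/-- The `φ`-Matsumoto change `F² / (F - Φ)` of `F`. -/
def matsumoto (F : TangentBundle (𝓡 n) M → ℝ) (φ : PiField n M)
    (u : TangentBundle (𝓡 n) M) : ℝ :=
  F u ^ 2 / (F u - assocForm F φ u)

/-- The vector fields `G` and `G'` are projectively related on `D`: `G' = G - 2 A C` on `D` for
some function `A` that is positively homogeneous of degree `1`. -/
def ProjectivelyRelated (D : Set (TangentBundle (𝓡 n) M)) (G G' : TMField n M) : Prop :=
  ∃ A : TangentBundle (𝓡 n) M → ℝ,
    (∀ u ∈ D, ∀ c : ℝ, 0 < c → A (scale c u) = c * A u) ∧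
    ∀ x : M, ∀ p ∈ chartDom D x,
      chartField G' x p =
        chartField G x p - (2 * A ((natChart x).symm p)) • Local.liouville p

end Global

end

/-! Suppose the spray of `l = F² / (F - Φ)` is `G - a C`. Write `f_z` for the derivative of `f`
along the vertical vector `(0, z)` and `d_h f (z)` for the one along the horizontal lift of `z`. The
energy is horizontally constant (`IsGeodesicSpray.fderiv_horProj`), so `d_h F = 0`. Concurrence
gives `d_h Φ (z) = - F F_z` (`IsConcurrent.assoc_fderiv_hor`). Hence `d_h l (z) = - l F F_z / (F -
Φ)`, and taking `z = y` yields `G l = - l²`.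

Energy is conserved along its own geodesic spray, which forces `a = - l`. The Euler–Lagrange
equations for `l` then become `l l_z = - d_h l (z)` (`fderiv_of_projective`). Comparison with the
quotient rule for `l` leaves `F² Φ_z = Φ E_z`, that is, `g (F² φ, z) = Φ g (y, z)` for every `z`. By
nondegeneracy `F² φ = Φ y` (`collinear_of_projective`).

But `φ` does not vary along the fibre, while the direction of `y` does. Differentiating the relation
along `(0, z)` makes every `z` a multiple of `y` (`exists_smul_of_collinear`), which is impossible
when `n ≥ 2`. -/

open Filter Topology

/-! ### Second derivatives, Euler identities and the Euler–Lagrange equations in a chart -/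

namespace Local

variable {n : ℕ}

/-- A smooth function is twice differentiable. -/
theorem hasFDerivAt_fderiv {e : Phase n → ℝ} {p : Phase n} (he : ContDiffAt ℝ ∞ e p) :
    HasFDerivAt (fderiv ℝ e) (fderiv ℝ (fderiv ℝ e) p) p :=
  ((he.fderiv_right (m := 1) (by norm_cast)).differentiableAt (by norm_num)).hasFDerivAt

theorem second_fderiv_symm {e : Phase n → ℝ} {p : Phase n} (he : ContDiffAt ℝ ∞ e p)
    (V W : Phase n) : fderiv ℝ (fderiv ℝ e) p V W = fderiv ℝ (fderiv ℝ e) p W V :=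
  (he.isSymmSndFDerivAt (by rw [minSmoothness_of_isRCLikeNormedField]; exact ENat.LEInfty.out)).eq V W

theorem hasFDerivAt_fderiv_apply {e : Phase n → ℝ} {V : Phase n → Phase n} {p : Phase n}
    {V' : Phase n →L[ℝ] Phase n} (he : ContDiffAt ℝ ∞ e p) (hV : HasFDerivAt V V' p)
    (W : Phase n) :
    fderiv ℝ (fun q => fderiv ℝ e q (V q)) p W =
      fderiv ℝ (fderiv ℝ e) p W (V p) + fderiv ℝ e p (V' W) := by
  rw [((hasFDerivAt_fderiv he).clm_apply hV).fderiv]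
  simp [add_comm]

theorem fderiv_energy {f : Phase n → ℝ} {p : Phase n} (hf : DifferentiableAt ℝ f p)
    (W : Phase n) : fderiv ℝ (fun q => f q ^ 2 / 2) p W = f p * fderiv ℝ f p W := by
  have h := ((hf.hasFDerivAt.pow 2).mul_const (1 / 2 : ℝ)).fderiv
  simp only [mul_one_div] at h
  rw [h]
  simp only [smul_apply, smul_eq_mul, nsmul_eq_mul]
  norm_num
  ring

/-- `J` has constant coefficients in a natural chart, so differentiating `d_J e` produces only
second derivatives of `e`. -/
theorem ddJ_eq {e : Phase n → ℝ} {p : Phase n} (he : ContDiffAt ℝ ∞ e p) (W Z : Phase n) :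
    ddJ e p W Z =
      fderiv ℝ (fderiv ℝ e) p W (0, Z.1) - fderiv ℝ (fderiv ℝ e) p Z (0, W.1) := by
  have h := (hasFDerivAt_fderiv he).clm_comp (hasFDerivAt_const (vertJ (n := n)) p)
  have h' : fderiv ℝ (dJ e) p = _ := h.fderiv
  simp [ddJ, h', vertJ, gam, rho]

/-- The second derivative along two lines. -/
theorem deriv_deriv_line {e : Phase n → ℝ} {Ω : Set (Phase n)} (hΩ : IsOpen Ω)
    (he : ContDiffOn ℝ ∞ e Ω) {p : Phase n} (hp : p ∈ Ω) (V W : Phase n) :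
    deriv (fun s : ℝ => deriv (fun t : ℝ => e ((p + s • V) + t • W)) 0) 0 =
      fderiv ℝ (fderiv ℝ e) p V W := by
  have hline : ∀ q U : Phase n, HasDerivAt (fun t : ℝ => q + t • U) U 0 := fun q U => by
    simpa using ((hasDerivAt_id (0 : ℝ)).smul_const U).const_add q
  have h0 : ∀ q U : Phase n, q + (0 : ℝ) • U = q := fun q U => by rw [zero_smul, add_zero]
  have hin : ∀ᶠ s : ℝ in 𝓝 0, p + s • V ∈ Ω := by
    have hc : ContinuousAt (fun s : ℝ => p + s • V) 0 := (hline p V).continuousAt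
    exact hc.eventually_mem (hΩ.mem_nhds (by rwa [h0]))
  have hinner : (fun s : ℝ => deriv (fun t : ℝ => e ((p + s • V) + t • W)) 0) =ᶠ[𝓝 0]
      fun s => fderiv ℝ e (p + s • V) W := by
    filter_upwards [hin] with s hs
    have hd := ((he.contDiffAt (hΩ.mem_nhds hs)).differentiableAt (by simp)).hasFDerivAt
    rw [← h0 (p + s • V) W] at hd
    have h := (hd.comp_hasDerivAt (0 : ℝ) (hline (p + s • V) W)).deriv
    rw [h0] at h
    exact h
  have hd : HasFDerivAt (fun q => fderiv ℝ e q W) ((fderiv ℝ (fderiv ℝ e) p).flip W)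
      (p + (0 : ℝ) • V) := by
    rw [h0]
    have h := (hasFDerivAt_fderiv (he.contDiffAt (hΩ.mem_nhds hp))).clm_apply
      (hasFDerivAt_const W p)
    simpa using h
  rw [hinner.deriv_eq]
  exact (hd.comp_hasDerivAt (0 : ℝ) (hline p V)).deriv

/-- Euler's identity for a function that is positively homogeneous of degree `2`. -/
theorem euler_two {e : Phase n → ℝ} {p : Phase n} (he : ContDiffAt ℝ ∞ e p)
    (hom : ∀ c : ℝ, 0 < c → e (p.1, c • p.2) = c ^ 2 * e p) :
    fderiv ℝ e p (0, p.2) = 2 * e p := by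
  have hl : HasDerivAt (fun c : ℝ => ((p.1, c • p.2) : Phase n)) (0, p.2) 1 := by
    have := (hasDerivAt_const (1 : ℝ) p.1).prodMk ((hasDerivAt_id (1 : ℝ)).smul_const p.2)
    simpa using this
  have hp : ((p.1, (1 : ℝ) • p.2) : Phase n) = p := by simp
  have h1 : HasDerivAt (fun c : ℝ => e (p.1, c • p.2)) (fderiv ℝ e p (0, p.2)) 1 := by
    have hd : HasFDerivAt e (fderiv ℝ e p) ((p.1, (1 : ℝ) • p.2) : Phase n) := by
      rw [hp]; exact (he.differentiableAt (by simp)).hasFDerivAt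
    exact hd.comp_hasDerivAt (1 : ℝ) hl
  have h2 : HasDerivAt (fun c : ℝ => c ^ 2 * e p) (2 * e p) 1 := by
    simpa using (hasDerivAt_pow 2 (1 : ℝ)).mul_const (e p)
  refine h1.unique (h2.congr_of_eventuallyEq ?_)
  filter_upwards [lt_mem_nhds (zero_lt_one' ℝ)] with c hc using hom c hc

/-- Positively homogeneous of degree `2` in the fibre, on a set `Ω`. -/
def EulerTwo (Ω : Set (Phase n)) (e : Phase n → ℝ) : Prop :=
  ∀ p ∈ Ω, fderiv ℝ e p (0, p.2) = 2 * e p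

/-- Euler's identity differentiated along `W`. For `W = (0, w)` it becomes `g (y, w) = de (0, w)`.
-/
theorem EulerTwo.second {Ω : Set (Phase n)} {e : Phase n → ℝ} (hΩ : IsOpen Ω)
    (hE : EulerTwo Ω e) {p : Phase n} (hp : p ∈ Ω) (he : ContDiffAt ℝ ∞ e p) (W : Phase n) :
    fderiv ℝ (fderiv ℝ e) p W (0, p.2) + fderiv ℝ e p (0, W.2) = 2 * fderiv ℝ e p W := by
  have hV : HasFDerivAt (fun q : Phase n => ((0, q.2) : Phase n))
      ((0 : Phase n →L[ℝ] Vec n).prod (ContinuousLinearMap.snd ℝ _ _)) p :=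
    (hasFDerivAt_const _ p).prodMk hasFDerivAt_snd
  have h := hasFDerivAt_fderiv_apply he hV W
  have hev : (fun q => fderiv ℝ e q (0, q.2)) =ᶠ[𝓝 p] fun q => 2 * e q := by
    filter_upwards [hΩ.mem_nhds hp] with q hq using hE q hq
  rw [hev.fderiv_eq, fderiv_const_mul (he.differentiableAt (by simp))] at h
  simpa using h.symm

/-- The Euler–Lagrange equations along a vector field `g` with `i_g d d_J e = - d e`. -/
theorem eulerLagrange {Ω : Set (Phase n)} {e : Phase n → ℝ} (hΩ : IsOpen Ω)
    (hE : EulerTwo Ω e) {p : Phase n} (hp : p ∈ Ω) (he : ContDiffAt ℝ ∞ e p) {g : Phase n}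
    (hg : g.1 = p.2) (hgeo : ∀ Z, ddJ e p g Z = - fderiv ℝ e p Z) (z : Vec n) :
    fderiv ℝ (fderiv ℝ e) p g (0, z) = fderiv ℝ e p (z, 0) := by
  have h1 := hgeo (z, 0)
  have h2 := hE.second hΩ hp he (z, 0)
  rw [ddJ_eq he, hg] at h1
  simp only [Prod.mk_zero_zero, map_zero, add_zero] at h1 h2
  linarith

/-- Conservation of energy: the alternating form `d d_J e` vanishes on `(g, g)`. -/
theorem fderiv_geodesic_eq_zero {e : Phase n → ℝ} {p g : Phase n}
    (hgeo : ∀ Z, ddJ e p g Z = - fderiv ℝ e p Z) : fderiv ℝ e p g = 0 := by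
  have := hgeo g
  simp only [ddJ, sub_self] at this
  linarith

/-! ### Sprays and their horizontal lifts -/

section Spray

variable {Ω : Set (Phase n)} {G : Phase n → Phase n}

theorem IsSpray.fst_eq (hG : IsSpray Ω G) {p : Phase n} (hp : p ∈ Ω) : (G p).1 = p.2 := by
  have := (hG.2 p hp).1
  simpa [vertJ, liouville, gam, rho] using this

theorem IsSpray.hasFDerivAt (hΩ : IsOpen Ω) (hG : IsSpray Ω G) {p : Phase n} (hp : p ∈ Ω) :
    HasFDerivAt G (fderiv ℝ G p) p :=
  ((hG.1.contDiffAt (hΩ.mem_nhds hp)).differentiableAt (by simp)).hasFDerivAt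

theorem IsSpray.fderiv_fst (hΩ : IsOpen Ω) (hG : IsSpray Ω G) {p : Phase n} (hp : p ∈ Ω)
    (W : Phase n) : (fderiv ℝ G p W).1 = W.2 := by
  have h1 := (hG.hasFDerivAt hΩ hp).fst
  have h2 : HasFDerivAt (fun q : Phase n => (G q).1) (ContinuousLinearMap.snd ℝ _ _) p := by
    refine (hasFDerivAt_snd (𝕜 := ℝ) (p := p)).congr_of_eventuallyEq ?_
    filter_upwards [hΩ.mem_nhds hp] with q hq using hG.fst_eq hq
  exact DFunLike.congr_fun (h1.unique h2) W

/-- Euler's identity for the vertical components of a spray, which `[C, G] = G` makes homogeneous of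
degree `2`. -/
theorem IsSpray.fderiv_vert_self (hG : IsSpray Ω G) {p : Phase n} (hp : p ∈ Ω) :
    (fderiv ℝ G p (0, p.2)).2 = (2 : ℝ) • (G p).2 := by
  have h := (hG.2 p hp).2
  have hl : fderiv ℝ (liouville (n := n)) p =
      (gam (n := n)).comp (ContinuousLinearMap.snd ℝ _ _) :=
    ((gam (n := n)).comp (ContinuousLinearMap.snd ℝ (Vec n) (Vec n))).hasFDerivAt (x := p) |>.fderiv
  rw [VectorField.lieBracket, hl] at h
  have h2 := congrArg Prod.snd h
  simp only [liouville, gam, Prod.snd_sub, ContinuousLinearMap.comp_apply,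
    ContinuousLinearMap.inr_apply, ContinuousLinearMap.coe_snd'] at h2
  rw [two_smul, ← sub_eq_iff_eq_add]
  exact h2

theorem barthel_eq (G : Phase n → Phase n) (p W : Phase n) :
    barthel G p W = fderiv ℝ G p (0, W.1) - (0, (fderiv ℝ G p W).1) := by
  simp [barthel, VectorField.lieBracket, vertJ, gam, rho]

theorem horProj_eq (G : Phase n → Phase n) (p : Phase n) (z : Vec n) :
    horProj G p (z, 0) =
      (1 / 2 : ℝ) • ((z, 0) + (fderiv ℝ G p (0, z) - (0, (fderiv ℝ G p (z, 0)).1))) := by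
  rw [horProj, barthel_eq]

theorem IsSpray.horProj_eq (hΩ : IsOpen Ω) (hG : IsSpray Ω G) {p : Phase n} (hp : p ∈ Ω)
    (z : Vec n) : horProj G p (z, 0) = (z, (1 / 2 : ℝ) • (fderiv ℝ G p (0, z)).2) := by
  rw [Local.horProj_eq]
  ext1
  · simp only [Prod.smul_fst, Prod.fst_add, Prod.fst_sub, hG.fderiv_fst hΩ hp, sub_zero]
    rw [← two_smul ℝ z, smul_smul]; norm_num
  · simp [hG.fderiv_fst hΩ hp]

/-- A spray is horizontal: the degree `2` of its vertical components cancels the factor `1/2` in the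
horizontal projector. -/
theorem IsSpray.horProj_self (hΩ : IsOpen Ω) (hG : IsSpray Ω G) {p : Phase n} (hp : p ∈ Ω) :
    horProj G p (p.2, 0) = G p := by
  rw [hG.horProj_eq hΩ hp, hG.fderiv_vert_self hp, smul_smul]
  ext1
  · simp [hG.fst_eq hp]
  · norm_num

theorem IsSpray.verProj_vert (hΩ : IsOpen Ω) (hG : IsSpray Ω G) {p : Phase n} (hp : p ∈ Ω)
    (w : Vec n) : verProj G p (0, w) = (0, w) := by
  rw [verProj, barthel_eq, hG.fderiv_fst hΩ hp]
  simp only [Prod.mk_zero_zero, map_zero, zero_sub, sub_neg_eq_add, ← two_smul ℝ ((0, w) : Phase n),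
    smul_smul]
  norm_num

theorem IsSpray.differentiableAt_betaF (hΩ : IsOpen Ω) (hG : IsSpray Ω G) {p : Phase n}
    (hp : p ∈ Ω) {X : Phase n → Vec n} (hX : DifferentiableAt ℝ X p) :
    DifferentiableAt ℝ (betaF G X) p := by
  have hG' : DifferentiableAt ℝ (fderiv ℝ G) p :=
    ((hG.1.contDiffAt (hΩ.mem_nhds hp)).fderiv_right (m := 1) (by norm_cast)).differentiableAt
      (by norm_num)
  have : betaF G X = fun q => (1 / 2 : ℝ) • ((X q, 0) +
      (fderiv ℝ G q (0, X q) - (0, (fderiv ℝ G q (X q, 0)).1))) := by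
    funext q; rw [betaF, Local.horProj_eq]
  rw [this]
  fun_prop

theorem IsSpray.fderiv_betaF_fst (hΩ : IsOpen Ω) (hG : IsSpray Ω G) {p : Phase n}
    (hp : p ∈ Ω) {X : Phase n → Vec n} (hX : DifferentiableAt ℝ X p) (W : Phase n) :
    (fderiv ℝ (betaF G X) p W).1 = fderiv ℝ X p W := by
  have h1 := (hG.differentiableAt_betaF hΩ hp hX).hasFDerivAt.fst
  have h2 : HasFDerivAt (fun q : Phase n => (betaF G X q).1) (fderiv ℝ X p) p := by
    refine hX.hasFDerivAt.congr_of_eventuallyEq ?_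
    filter_upwards [hΩ.mem_nhds hp] with q hq
    rw [betaF, hG.horProj_eq hΩ hq]
  exact DFunLike.congr_fun (h1.unique h2) W

/-- The Euler–Lagrange expression of a function along a spray, in terms of horizontal
derivatives. -/
theorem IsSpray.eulerLagrange_eq (hΩ : IsOpen Ω) (hG : IsSpray Ω G) {p : Phase n} (hp : p ∈ Ω)
    {l : Phase n → ℝ} (hl : ContDiffAt ℝ ∞ l p) (z : Vec n) :
    fderiv ℝ (fun q => fderiv ℝ l q (G q)) p (0, z)
        - 2 * fderiv ℝ l p (horProj G p (z, 0)) =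
      fderiv ℝ (fderiv ℝ l) p (G p) (0, z) - fderiv ℝ l p (z, 0) := by
  rw [hasFDerivAt_fderiv_apply hl (hG.hasFDerivAt hΩ hp), second_fderiv_symm hl,
    hG.horProj_eq hΩ hp]
  -- The connection coefficients enter once through the derivative of `G` and twice with factor
  -- `1/2` through the horizontal lift, so they cancel.
  have h1 : fderiv ℝ G p (0, z) = (z, 0) + (0, (fderiv ℝ G p (0, z)).2) := by
    ext1 <;> simp [hG.fderiv_fst hΩ hp]
  have h2 : ((z, (1 / 2 : ℝ) • (fderiv ℝ G p (0, z)).2) : Phase n) =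
      (z, 0) + (1 / 2 : ℝ) • (0, (fderiv ℝ G p (0, z)).2) := by
    ext1 <;> simp
  rw [h2, map_add, map_smul, smul_eq_mul]
  conv_lhs => rw [h1]
  rw [map_add]
  simp only [Prod.snd_add, zero_add]
  ring

/-- In `IsSpray.eulerLagrange_eq`, the term in `G e` vanishes by conservation of energy and the
right-hand side by the Euler–Lagrange equations. -/
theorem IsGeodesicSpray.fderiv_horProj {e : Phase n → ℝ} (hΩ : IsOpen Ω) (hE : EulerTwo Ω e)
    (he : ContDiffOn ℝ ∞ e Ω) (hG : IsGeodesicSpray Ω e G) {p : Phase n} (hp : p ∈ Ω)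
    (z : Vec n) : fderiv ℝ e p (horProj G p (z, 0)) = 0 := by
  have hep := he.contDiffAt (hΩ.mem_nhds hp)
  have h1 := hG.1.eulerLagrange_eq hΩ hp hep z
  have h2 : (fun q => fderiv ℝ e q (G q)) =ᶠ[𝓝 p] fun _ => (0 : ℝ) := by
    filter_upwards [hΩ.mem_nhds hp] with q hq using fderiv_geodesic_eq_zero (hG.2 q hq)
  rw [h2.fderiv_eq, eulerLagrange hΩ hE hp hep (hG.1.fst_eq hp) (hG.2 p hp) z] at h1
  simp only [fderiv_const_apply, zero_apply] at h1
  linarith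

end Spray

end Local

/-! ### Concurrent fields and the projective form of the geodesic equation -/

namespace Local

variable {n : ℕ} {Ω : Set (Phase n)} {e : Phase n → ℝ} {G : Phase n → Phase n}
  {φ : Phase n → Vec n}

/-- The base components of `β φ` are those of `φ`, so `ρ [γ z, β φ]` is the vertical derivative of
`φ`. -/
theorem IsConcurrent.fderiv_vert (hΩ : IsOpen Ω) (hG : IsSpray Ω G)
    (hφs : ContDiffOn ℝ ∞ φ Ω) (hφ : IsConcurrent Ω e G φ) {p : Phase n} (hp : p ∈ Ω)
    (z : Vec n) : fderiv ℝ φ p (0, z) = 0 := by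
  have h := ((hφ (fun _ => z) contDiffOn_const).2.2 p hp).2
  have hd := (hφs.contDiffAt (hΩ.mem_nhds hp)).differentiableAt (by simp)
  have hg : gamF (fun _ : Phase n => z) = fun _ => ((0, z) : Phase n) := rfl
  rw [berwaldVer, VectorField.lieBracket, hg] at h
  simpa [rho, hG.fderiv_betaF_fst hΩ hp hd] using h

/-- The horizontal derivative of `φ`, with the Christoffel term of the Berwald connection. -/
theorem IsConcurrent.fderiv_hor (hΩ : IsOpen Ω) (hG : IsSpray Ω G)
    (hφs : ContDiffOn ℝ ∞ φ Ω) (hφ : IsConcurrent Ω e G φ) {p : Phase n} (hp : p ∈ Ω)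
    (z : Vec n) :
    fderiv ℝ φ p (horProj G p (z, 0)) - (fderiv ℝ (betaF G fun _ => z) p (0, φ p)).2 = -z := by
  have h := ((hφ (fun _ => z) contDiffOn_const).2.2 p hp).1
  have hd := ((hφs.contDiffAt (hΩ.mem_nhds hp)).differentiableAt (by simp)).hasFDerivAt
  have hg : HasFDerivAt (gamF φ) ((0 : Phase n →L[ℝ] Vec n).prod (fderiv ℝ φ p)) p :=
    (hasFDerivAt_const (0 : Vec n) p).prodMk hd
  have h1 : (fderiv ℝ (betaF G fun _ => z) p (0, φ p)).1 = 0 := by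
    rw [hG.fderiv_betaF_fst hΩ hp (differentiableAt_const z)]; simp
  have h2 : VectorField.lieBracket ℝ (betaF G fun _ => z) (gamF φ) p =
      (0, fderiv ℝ φ p (horProj G p (z, 0)) - (fderiv ℝ (betaF G fun _ => z) p (0, φ p)).2) := by
    rw [VectorField.lieBracket, hg.fderiv]
    have h3 : gamF φ p = (0, φ p) := rfl
    have h4 : betaF G (fun _ => z) p = horProj G p (z, 0) := rfl
    rw [h3, h4]
    ext1
    · simp [h1]
    · simp
  rw [berwaldHor, h2, hG.verProj_vert hΩ hp] at h
  exact h

/-- The vertical derivative of `g (φ, y)`. -/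
theorem IsConcurrent.assoc_fderiv_vert (hΩ : IsOpen Ω) (he : ContDiffOn ℝ ∞ e Ω)
    (hG : IsSpray Ω G) (hφs : ContDiffOn ℝ ∞ φ Ω) (hφ : IsConcurrent Ω e G φ) {p : Phase n}
    (hp : p ∈ Ω) (z : Vec n) :
    fderiv ℝ (fun q => fderiv ℝ e q (0, φ q)) p (0, z) =
      fderiv ℝ (fderiv ℝ e) p (0, z) (0, φ p) := by
  have hd := ((hφs.contDiffAt (hΩ.mem_nhds hp)).differentiableAt (by simp)).hasFDerivAt
  have hV : HasFDerivAt (fun q => ((0, φ q) : Phase n))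
      ((0 : Phase n →L[ℝ] Vec n).prod (fderiv ℝ φ p)) p := (hasFDerivAt_const _ p).prodMk hd
  rw [hasFDerivAt_fderiv_apply (he.contDiffAt (hΩ.mem_nhds hp)) hV]
  rw [ContinuousLinearMap.prod_apply, hφ.fderiv_vert hΩ hG hφs hp, zero_apply]
  exact add_eq_left.2 (map_zero _)

/-- The horizontal derivative of `g (φ, y)`. -/
theorem IsConcurrent.assoc_fderiv_hor (hΩ : IsOpen Ω) (he : ContDiffOn ℝ ∞ e Ω)
    (hE : EulerTwo Ω e) (hG : IsGeodesicSpray Ω e G) (hφs : ContDiffOn ℝ ∞ φ Ω)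
    (hφ : IsConcurrent Ω e G φ) {p : Phase n} (hp : p ∈ Ω) (z : Vec n) :
    fderiv ℝ (fun q => fderiv ℝ e q (0, φ q)) p (horProj G p (z, 0)) =
      - fderiv ℝ e p (0, z) := by
  have hep := he.contDiffAt (hΩ.mem_nhds hp)
  have hd := ((hφs.contDiffAt (hΩ.mem_nhds hp)).differentiableAt (by simp)).hasFDerivAt
  have hV : HasFDerivAt (fun q => ((0, φ q) : Phase n))
      ((0 : Phase n →L[ℝ] Vec n).prod (fderiv ℝ φ p)) p := (hasFDerivAt_const _ p).prodMk hd
  have hB := (hG.1.differentiableAt_betaF hΩ hp (differentiableAt_const z)).hasFDerivAt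
  -- The identity `de (β z) = 0` is differentiated along `(0, φ)`; this trades the mixed second
  -- derivative of `e` for the Christoffel term of `D°`.
  have h1 := hasFDerivAt_fderiv_apply hep hB (0, φ p)
  have h2 : (fun q => fderiv ℝ e q (betaF G (fun _ => z) q)) =ᶠ[𝓝 p] fun _ => (0 : ℝ) := by
    filter_upwards [hΩ.mem_nhds hp] with q hq using hG.fderiv_horProj hΩ hE he hq z
  have h3 : fderiv ℝ (betaF G fun _ => z) p (0, φ p) =
      (0, (fderiv ℝ (betaF G fun _ => z) p (0, φ p)).2) := by
    ext1
    · rw [hG.1.fderiv_betaF_fst hΩ hp (differentiableAt_const z)]; simp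
    · rfl
  have h4 : ((0, z) : Phase n) = (0, (fderiv ℝ (betaF G fun _ => z) p (0, φ p)).2) -
      (0, fderiv ℝ φ p (horProj G p (z, 0))) := by
    ext1
    · simp
    · have h := hφ.fderiv_hor hΩ hG.1 hφs hp z
      simp only [Prod.snd_sub]
      rw [← neg_sub, h, neg_neg]
  rw [h2.fderiv_eq, h3, second_fderiv_symm hep] at h1
  rw [hasFDerivAt_fderiv_apply hep hV, h4, map_sub]
  have h5 : betaF G (fun _ => z) p = horProj G p (z, 0) := rfl
  simp only [fderiv_const_apply, zero_apply, h5] at h1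
  simp only [ContinuousLinearMap.prod_apply, zero_apply]
  linarith

/-- A nonnegative homogeneous function whose energy has maximal rank is positive off the zero
section. -/
theorem pos_of_maxRank {f : Phase n → ℝ} (hΩ : IsOpen Ω)
    (he : ContDiffOn ℝ ∞ (fun q => f q ^ 2 / 2) Ω) (hE : EulerTwo Ω fun q => f q ^ 2 / 2)
    {p : Phase n} (hp : p ∈ Ω) (hf : 0 ≤ f p) (hmax : MaxRank (fun q => f q ^ 2 / 2) p)
    (hp2 : p.2 ≠ 0) : 0 < f p := by
  refine hf.lt_of_ne' fun h0 => hp2 ?_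
  have hep := he.contDiffAt (hΩ.mem_nhds hp)
  -- At a zero of `f` the energy is minimal, so `de = 0`; the differentiated Euler identity then
  -- puts `(0, y)` in the kernel of `d d_J e`.
  have hmin : IsLocalMin (fun q => f q ^ 2 / 2) p :=
    Eventually.of_forall fun q => by
      have : (0 : ℝ) ≤ f q ^ 2 / 2 := by positivity
      simpa [h0] using this
  have hz := hmin.fderiv_eq_zero
  have hW : ((0, p.2) : Phase n) = 0 := hmax _ fun Z => by
    have h := hE.second hΩ hp hep (0, Z.1)
    rw [hz] at h
    simp only [zero_apply, mul_zero, add_zero] at h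
    rw [ddJ_eq hep, second_fderiv_symm hep, h]
    exact sub_eq_zero.2 (map_zero _).symm
  exact (Prod.ext_iff.1 hW).2

/-- The geodesic equation of `l ^ 2 / 2` along `G - a C`, for `l` with `G l = - l ^ 2`. -/
theorem fderiv_of_projective {l : Phase n → ℝ} {D : Set (Phase n)} (hD : IsOpen D)
    (hG : IsSpray D G) (hl : ContDiffOn ℝ ∞ l D) (hE : EulerTwo D fun q => l q ^ 2 / 2)
    (hGl : ∀ q ∈ D, fderiv ℝ l q (G q) = - l q ^ 2) {p : Phase n} (hp : p ∈ D) (hlp : l p ≠ 0)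
    {a : ℝ} (hgeo : ∀ Z, ddJ (fun q => l q ^ 2 / 2) p (G p - a • liouville p) Z =
      - fderiv ℝ (fun q => l q ^ 2 / 2) p Z) (z : Vec n) :
    fderiv ℝ l p (0, z) * l p = - fderiv ℝ l p (horProj G p (z, 0)) := by
  have hdl : ∀ q ∈ D, fderiv ℝ (fun q => l q ^ 2 / 2) q = l q • fderiv ℝ l q := fun q hq => by
    refine DFunLike.ext _ _ fun W => ?_
    exact fderiv_energy ((hl.contDiffAt (hD.mem_nhds hq)).differentiableAt (by simp)) W
  have hlp' := hl.contDiffAt (hD.mem_nhds hp)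
  have hep : ContDiffAt ℝ ∞ (fun q => l q ^ 2 / 2) p := (hlp'.pow 2).div_const 2
  have hC : liouville p = (0, p.2) := rfl
  have hg1 : (G p - a • liouville p).1 = p.2 := by simp [hC, hG.fst_eq hp]
  have h1 := fderiv_geodesic_eq_zero hgeo
  have h2 := eulerLagrange hD hE hp hep hg1 hgeo z
  have h3 := hE.second hD hp hep (0, z)
  have h4 := hG.eulerLagrange_eq hD hp hep z
  have h5 : (fun q => fderiv ℝ (fun q => l q ^ 2 / 2) q (G q)) =ᶠ[𝓝 p] fun q => - l q ^ 3 := by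
    filter_upwards [hD.mem_nhds hp] with q hq
    rw [hdl q hq, smul_apply, hGl q hq, smul_eq_mul]
    ring
  have h6 : fderiv ℝ (fun q => - l q ^ 3) p (0, z) = - (3 * l p ^ 2 * fderiv ℝ l p (0, z)) := by
    have h := (hlp'.differentiableAt (by simp)).hasFDerivAt
    have h' : fderiv ℝ (fun q => - l q ^ 3) p = _ := (h.pow 3).neg.fderiv
    rw [h']
    simp
  have h7 := hE p hp
  have h8 := h5.self_of_nhds
  simp only at h7 h8
  rw [map_sub, map_smul, hC, h7, h8] at h1
  -- Conservation of energy along `G - a C` reads `- l³ - a l² = 0`.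
  have ha : a = - l p := by
    have h8 : l p ^ 2 * (a + l p) = 0 := by
      simp only [smul_eq_mul] at h1
      linear_combination -h1
    have := (mul_eq_zero.1 h8).resolve_left (pow_ne_zero 2 hlp)
    linarith
  rw [h5.fderiv_eq, h6] at h4
  rw [second_fderiv_symm hep] at h3
  rw [map_sub, sub_apply, map_smul, smul_apply, smul_eq_mul, hC] at h2
  rw [hdl p hp] at h2 h3 h4
  simp only [smul_apply, smul_eq_mul] at h2 h3 h4
  -- With `a = - l` the right-hand side of `h4` is `- l² l_z`, while its left-hand side is `- 3 l²
  -- l_z - 2 l d_h l (z)`.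
  have : l p * (fderiv ℝ l p (0, z) * l p + fderiv ℝ l p (horProj G p (z, 0))) = 0 := by
    subst ha
    linear_combination (-1/2 : ℝ) * h4 - (1/2 : ℝ) * h2 + (l p / 2) * h3
  linarith [(mul_eq_zero.1 this).resolve_left hlp]

end Local

/-! ### Collinearity and the contradiction in a chart -/

namespace Local

variable {n : ℕ}

theorem fderiv_div_relation {u v : Phase n → ℝ} {p : Phase n} (hu : DifferentiableAt ℝ u p)
    (hv : DifferentiableAt ℝ v p) (hv0 : v p ≠ 0) (W : Phase n) :
    fderiv ℝ (fun q => u q / v q) p W * v p + u p / v p * fderiv ℝ v p W = fderiv ℝ u p W := by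
  have hl : DifferentiableAt ℝ (fun q => u q / v q) p := by
    simpa only [div_eq_mul_inv] using hu.fun_mul (hv.fun_inv hv0)
  have h1 : (fun q => u q / v q * v q) =ᶠ[𝓝 p] u := by
    filter_upwards [hv.continuousAt.eventually_ne hv0] with q hq using div_mul_cancel₀ _ hq
  have h2 : fderiv ℝ (fun q => u q / v q * v q) p = _ :=
    (hl.hasFDerivAt.mul hv.hasFDerivAt).fderiv
  rw [← h1.fderiv_eq, h2]
  simp only [add_apply, smul_apply, smul_eq_mul]
  ring

/-- If `f ^ 2 φ = Φ y` on an open set where `φ` is vertically constant, then the fibre is a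
line. -/
theorem exists_smul_of_collinear {D : Set (Phase n)} (hD : IsOpen D) {s Φ : Phase n → ℝ}
    {φ : Phase n → Vec n} {p : Phase n} (hp : p ∈ D) (hs : DifferentiableAt ℝ s p)
    (hΦ : DifferentiableAt ℝ Φ p) (hφ : DifferentiableAt ℝ φ p) (hs0 : s p ≠ 0) (hφ0 : φ p ≠ 0)
    (hφz : ∀ z, fderiv ℝ φ p (0, z) = 0) (h : ∀ q ∈ D, s q • φ q = Φ q • q.2) (z : Vec n) :
    ∃ c : ℝ, c • p.2 = z := by
  have hΦ0 : Φ p ≠ 0 := fun h0 => by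
    have := h p hp
    rw [h0, zero_smul] at this
    exact (smul_ne_zero hs0 hφ0) this
  have h1 : (fun q => s q • φ q) =ᶠ[𝓝 p] fun q => Φ q • q.2 := by
    filter_upwards [hD.mem_nhds hp] with q hq using h q hq
  have h2 := (hs.hasFDerivAt.smul hφ.hasFDerivAt).fderiv
  have h3 := (hΦ.hasFDerivAt.smul (hasFDerivAt_snd (𝕜 := ℝ) (p := p))).fderiv
  have h4 := congrArg (fun l : Phase n →L[ℝ] Vec n => l (0, z)) h1.fderiv_eq
  -- The product rule on both sides; the derivative of `φ` drops out because `φ` is vertically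
  -- constant.
  have h5 : fderiv ℝ s p (0, z) • φ p = Φ p • z + fderiv ℝ Φ p (0, z) • p.2 := by
    have h2' := congrArg (fun l : Phase n →L[ℝ] Vec n => l (0, z)) h2
    have h3' := congrArg (fun l : Phase n →L[ℝ] Vec n => l (0, z)) h3
    have h23 := h2'.symm.trans (h4.trans h3')
    simpa [hφz z] using h23
  have h6 : φ p = ((s p)⁻¹ * Φ p) • p.2 := by
    rw [mul_smul, ← h p hp, inv_smul_smul₀ hs0]
  refine ⟨(Φ p)⁻¹ * (fderiv ℝ s p (0, z) * ((s p)⁻¹ * Φ p) - fderiv ℝ Φ p (0, z)), ?_⟩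
  rw [mul_smul, sub_smul, mul_smul, ← h6, h5, add_sub_cancel_right, inv_smul_smul₀ hΦ0]

variable {Ω D : Set (Phase n)} {f : Phase n → ℝ} {G : Phase n → Phase n} {φ : Phase n → Vec n}

/-- A projective relation between `f` and its Matsumoto change forces `φ` to be collinear with
the position vector. -/
theorem collinear_of_projective (hΩ : IsOpen Ω) (hfs : ContDiffOn ℝ ∞ f Ω)
    (hfpos : ∀ p ∈ Ω, 0 < f p) (hE : EulerTwo Ω fun q => f q ^ 2 / 2)
    (hmax : ∀ p ∈ Ω, MaxRank (fun q => f q ^ 2 / 2) p)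
    (hG : IsGeodesicSpray Ω (fun q => f q ^ 2 / 2) G) (hφs : ContDiffOn ℝ ∞ φ Ω)
    (hφ : IsConcurrent Ω (fun q => f q ^ 2 / 2) G φ) (hD : IsOpen D) (hDΩ : D ⊆ Ω)
    {Φ : Phase n → ℝ} (hΦ : ∀ q ∈ D, Φ q = fderiv ℝ (fun q => f q ^ 2 / 2) q (0, φ q))
    (hlt : ∀ p ∈ D, Φ p < f p) (hEl : EulerTwo D fun q => (f q ^ 2 / (f q - Φ q)) ^ 2 / 2)
    {a : Phase n → ℝ} (hgeo : ∀ p ∈ D, ∀ Z,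
      ddJ (fun q => (f q ^ 2 / (f q - Φ q)) ^ 2 / 2) p (G p - a p • liouville p) Z =
        - fderiv ℝ (fun q => (f q ^ 2 / (f q - Φ q)) ^ 2 / 2) p Z) {p : Phase n} (hp : p ∈ D) :
    (f p ^ 2) • φ p = Φ p • p.2 := by
  have hes : ContDiffOn ℝ ∞ (fun q => f q ^ 2 / 2) Ω := (hfs.pow 2).div_const 2
  have hΦs : ContDiffOn ℝ ∞ Φ D :=
    (((hes.fderiv_of_isOpen hΩ (m := ∞) (by simp)).clm_apply
      (contDiffOn_const.prodMk hφs)).mono hDΩ).congr hΦ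
  have hΦ' : ∀ q ∈ D, fderiv ℝ Φ q =
      fderiv ℝ (fun q => fderiv ℝ (fun q => f q ^ 2 / 2) q (0, φ q)) q := fun q hq =>
    (eventuallyEq_of_mem (hD.mem_nhds hq) hΦ).fderiv_eq
  have hls : ContDiffOn ℝ ∞ (fun q => f q ^ 2 / (f q - Φ q)) D :=
    ((hfs.mono hDΩ).pow 2).div ((hfs.mono hDΩ).sub hΦs)
      fun q hq => (sub_pos.2 (hlt q hq)).ne'
  have hGD : IsSpray D G := ⟨hG.1.1.mono hDΩ, fun q hq => hG.1.2 q (hDΩ hq)⟩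
  have hfd : ∀ q ∈ D, DifferentiableAt ℝ f q := fun q hq =>
    (hfs.contDiffAt (hΩ.mem_nhds (hDΩ hq))).differentiableAt (by simp)
  have hΦd : ∀ q ∈ D, DifferentiableAt ℝ Φ q := fun q hq =>
    (hΦs.contDiffAt (hD.mem_nhds hq)).differentiableAt (by simp)
  have hrel : ∀ q ∈ D, ∀ W, fderiv ℝ (fun q => f q ^ 2 / (f q - Φ q)) q W * (f q - Φ q) +
      f q ^ 2 / (f q - Φ q) * (fderiv ℝ f q W - fderiv ℝ Φ q W) =
        2 * (f q * fderiv ℝ f q W) := fun q hq W => by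
    have h := fderiv_div_relation (u := fun q => f q ^ 2) (v := fun q => f q - Φ q)
      ((hfd q hq).pow 2) ((hfd q hq).sub (hΦd q hq)) (sub_pos.2 (hlt q hq)).ne' W
    have h1 : fderiv ℝ (fun q => f q - Φ q) q = _ := fderiv_sub (hfd q hq) (hΦd q hq)
    have h2 : fderiv ℝ (fun q => f q ^ 2) q = _ := ((hfd q hq).hasFDerivAt.pow 2).fderiv
    rw [h1, h2] at h
    simp only [sub_apply, smul_apply, smul_eq_mul, nsmul_eq_mul] at h
    norm_num at h
    linarith
  have hDf : ∀ q ∈ D, ∀ z, fderiv ℝ f q (horProj G q (z, 0)) = 0 := fun q hq z => by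
    have h := hG.fderiv_horProj hΩ hE hes (hDΩ hq) z
    rw [fderiv_energy (hfd q hq)] at h
    exact (mul_eq_zero.1 h).resolve_left (hfpos q (hDΩ hq)).ne'
  have hDl : ∀ q ∈ D, ∀ z, fderiv ℝ (fun q => f q ^ 2 / (f q - Φ q)) q (horProj G q (z, 0)) =
      - (f q ^ 2 / (f q - Φ q) * (f q * fderiv ℝ f q (0, z)) / (f q - Φ q)) := fun q hq z => by
    have h := hrel q hq (horProj G q (z, 0))
    have h' := hφ.assoc_fderiv_hor hΩ hes hE hG hφs (hDΩ hq) z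
    rw [fderiv_energy (hfd q hq), ← hΦ' q hq] at h'
    rw [hDf q hq, h'] at h
    rw [← neg_div, eq_div_iff (sub_pos.2 (hlt q hq)).ne']
    linarith
  have hGl : ∀ q ∈ D, fderiv ℝ (fun q => f q ^ 2 / (f q - Φ q)) q (G q) =
      - (f q ^ 2 / (f q - Φ q)) ^ 2 := fun q hq => by
    have h := hDl q hq q.2
    have h1 := hE q (hDΩ hq)
    rw [fderiv_energy (hfd q hq)] at h1
    rw [hGD.horProj_self hD hq, h1] at h
    rw [h]
    ring
  have hpΩ := hDΩ hp
  have hep := hes.contDiffAt (hΩ.mem_nhds hpΩ)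
  have hv := sub_pos.2 (hlt p hp)
  have hfp := hfpos p hpΩ
  have key : ∀ z, f p ^ 2 * fderiv ℝ Φ p (0, z) =
      Φ p * fderiv ℝ (fun q => f q ^ 2 / 2) p (0, z) := fun z => by
    have h1 := fderiv_of_projective hD hGD hls hEl hGl hp (div_pos (pow_pos hfp 2) hv).ne'
      (hgeo p hp) z
    have h2 := hrel p hp (0, z)
    rw [hDl p hp z, neg_neg] at h1
    -- Both sides of `h1` carry a factor `l`, positive because `F > Φ`, which is cancelled.
    have h3 : fderiv ℝ (fun q => f q ^ 2 / (f q - Φ q)) p (0, z) * (f p - Φ p) =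
        f p * fderiv ℝ f p (0, z) := by
      have h4 : f p ^ 2 / (f p - Φ p) ≠ 0 := (div_pos (pow_pos hfp 2) hv).ne'
      apply mul_left_cancel₀ h4
      rw [eq_div_iff hv.ne'] at h1
      linarith
    rw [h3, div_mul_eq_mul_div] at h2
    have h5 : f p ^ 2 * (fderiv ℝ f p (0, z) - fderiv ℝ Φ p (0, z)) =
        f p * fderiv ℝ f p (0, z) * (f p - Φ p) := by
      rw [← div_eq_iff hv.ne']; linarith
    rw [fderiv_energy (hfd p hp)]
    linear_combination -h5
  -- On a vertical vector `(0, w)` the form `d d_J e` is the metric pairing with `w`, so `key` puts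
  -- `F² φ - Φ y` in the kernel of the metric.
  have hW : ((0, (f p ^ 2) • φ p - Φ p • p.2) : Phase n) = 0 := hmax p hpΩ _ fun Z => by
    have h1 := key Z.1
    have h2 := hφ.assoc_fderiv_vert hΩ hes hG.1 hφs hpΩ Z.1
    rw [← hΦ' p hp] at h2
    have h3 := hE.second hΩ hpΩ hep (0, Z.1)
    have h4 : ((0, (f p ^ 2) • φ p - Φ p • p.2) : Phase n) =
        (f p ^ 2) • (0, φ p) - Φ p • (0, p.2) := by ext1 <;> simp
    have h5 : fderiv ℝ (fderiv ℝ fun q => f q ^ 2 / 2) p Z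
        (0, ((0, (f p ^ 2) • φ p - Φ p • p.2) : Phase n).1) = 0 := map_zero _
    rw [ddJ_eq hep, h5, second_fderiv_symm hep, h4, map_sub, map_smul, map_smul]
    simp only [smul_eq_mul]
    linear_combination h1 - f p ^ 2 * h2 - Φ p * h3
  exact sub_eq_zero.1 (Prod.ext_iff.1 hW).2

/-- The Matsumoto change by a concurrent field is not projective, in a chart. -/
theorem not_projective (hn : 2 ≤ n) (hΩ : IsOpen Ω) (hfs : ContDiffOn ℝ ∞ f Ω)
    (hf0 : ∀ p ∈ Ω, 0 ≤ f p) (hE : EulerTwo Ω fun q => f q ^ 2 / 2)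
    (hmax : ∀ p ∈ Ω, MaxRank (fun q => f q ^ 2 / 2) p) (hΩ0 : ∀ p ∈ Ω, p.2 ≠ 0)
    (hG : IsGeodesicSpray Ω (fun q => f q ^ 2 / 2) G) (hφs : ContDiffOn ℝ ∞ φ Ω)
    (hφ0 : ∀ p ∈ Ω, φ p ≠ 0)
    (hφ : IsConcurrent Ω (fun q => f q ^ 2 / 2) G φ) (hD : IsOpen D) (hDΩ : D ⊆ Ω)
    {Φ : Phase n → ℝ} (hΦ : ∀ q ∈ D, Φ q = fderiv ℝ (fun q => f q ^ 2 / 2) q (0, φ q))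
    (hlt : ∀ p ∈ D, Φ p < f p) (hEl : EulerTwo D fun q => (f q ^ 2 / (f q - Φ q)) ^ 2 / 2)
    {a : Phase n → ℝ} (hgeo : ∀ p ∈ D, ∀ Z,
      ddJ (fun q => (f q ^ 2 / (f q - Φ q)) ^ 2 / 2) p (G p - a p • liouville p) Z =
        - fderiv ℝ (fun q => (f q ^ 2 / (f q - Φ q)) ^ 2 / 2) p Z) {p : Phase n} :
    p ∉ D := by
  intro hp
  have hes : ContDiffOn ℝ ∞ (fun q => f q ^ 2 / 2) Ω := (hfs.pow 2).div_const 2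
  have hfpos : ∀ q ∈ Ω, 0 < f q := fun q hq =>
    pos_of_maxRank hΩ hes hE hq (hf0 q hq) (hmax q hq) (hΩ0 q hq)
  have hpΩ := hΩ.mem_nhds (hDΩ hp)
  have hΦs : ContDiffOn ℝ ∞ Φ D :=
    (((hes.fderiv_of_isOpen hΩ (m := ∞) (by simp)).clm_apply
      (contDiffOn_const.prodMk hφs)).mono hDΩ).congr hΦ
  have hspan := exists_smul_of_collinear hD hp (s := fun q => f q ^ 2)
    (((hfs.contDiffAt hpΩ).differentiableAt (by simp)).pow 2)
    ((hΦs.contDiffAt (hD.mem_nhds hp)).differentiableAt (by simp))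
    ((hφs.contDiffAt hpΩ).differentiableAt (by simp))
    (pow_pos (hfpos p (hDΩ hp)) 2).ne' (hφ0 p (hDΩ hp))
    (hφ.fderiv_vert hΩ hG.1 hφs (hDΩ hp))
    fun q hq => collinear_of_projective hΩ hfs hfpos hE hmax hG hφs hφ hD hDΩ hΦ hlt hEl hgeo hq
  have h1 := finrank_le_one (R := ℝ) p.2 hspan
  rw [finrank_euclideanSpace_fin] at h1
  omega

end Local

/-! ### Passage from the manifold to natural charts -/

section Global

variable {n : ℕ} {M : Type*} [TopologicalSpace M] [ChartedSpace (Vec n) M]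
  [IsManifold (𝓡 n) ∞ M]

theorem natChart_eq (x : M) : natChart (n := n) x =
    (trivializationAt (Vec n) (TangentSpace (𝓡 n) : M → Type _) x).toPartialEquiv ≫
      (extChartAt (𝓡 n) x).prod (PartialEquiv.refl (Vec n)) :=
  FiberBundle.extChartAt (IB := 𝓡 n) (⟨x, 0⟩ : TangentBundle (𝓡 n) M)

theorem natChart_target (x : M) : (natChart (n := n) x).target =
    ((extChartAt (𝓡 n) x).target ∩ (extChartAt (𝓡 n) x).symm ⁻¹'
      (trivializationAt (Vec n) (TangentSpace (𝓡 n) : M → Type _) x).baseSet) ×ˢ Set.univ :=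
  FiberBundle.extChartAt_target (IB := 𝓡 n) (⟨x, 0⟩ : TangentBundle (𝓡 n) M)

theorem mem_natChart_target {x : M} {p : Phase n} (hp : p ∈ (natChart (n := n) x).target)
    (v : Vec n) : (p.1, v) ∈ (natChart (n := n) x).target := by
  rw [natChart_target] at hp ⊢
  exact ⟨hp.1, trivial⟩

theorem isOpen_natChart_target (x : M) : IsOpen (natChart (n := n) x).target :=
  isOpen_extChartAt_target _

/-- In a natural chart, a fibre of the tangent bundle is identified linearly with `ℝⁿ`. -/
theorem exists_fibre_equiv {x : M} {p : Phase n} (hp : p ∈ (natChart (n := n) x).target) :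
    ∃ L : TangentSpace (𝓡 n) ((natChart x).symm p).proj ≃L[ℝ] Vec n,
      (∀ v : Vec n, (natChart x).symm (p.1, v) = ⟨((natChart x).symm p).proj, L.symm v⟩) ∧
      ∀ w, natChart x ⟨((natChart x).symm p).proj, w⟩ = (p.1, L w) := by
  set T := trivializationAt (Vec n) (TangentSpace (𝓡 n) : M → Type _) x
  have hb : (extChartAt (𝓡 n) x).symm p.1 ∈ T.baseSet := by
    rw [natChart_target] at hp; exact hp.1.2
  have hs : ∀ v : Vec n, (natChart x).symm (p.1, v) =
      ⟨(extChartAt (𝓡 n) x).symm p.1, T.symm ((extChartAt (𝓡 n) x).symm p.1) v⟩ := fun v => by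
    rw [natChart_eq]
    exact (T.mk_symm hb v).symm
  have hproj : ((natChart (n := n) x).symm p).proj = (extChartAt (𝓡 n) x).symm p.1 := by
    rw [show p = (p.1, p.2) from rfl, hs]
  -- The base point is generalised so that the equality `hproj` can be substituted in the type of
  -- the fibre.
  have main : ∀ b : M, b = (extChartAt (𝓡 n) x).symm p.1 →
      ∃ L : TangentSpace (𝓡 n) b ≃L[ℝ] Vec n,
      (∀ v : Vec n, (natChart x).symm (p.1, v) = ⟨b, L.symm v⟩) ∧
      ∀ w, natChart x ⟨b, w⟩ = (p.1, L w) := by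
    rintro b rfl
    have h1 : ∀ v : Vec n, (natChart x).symm (p.1, v) = ⟨(extChartAt (𝓡 n) x).symm p.1,
        (T.continuousLinearEquivAt ℝ _ hb).symm v⟩ := hs
    refine ⟨T.continuousLinearEquivAt ℝ _ hb, h1, fun w => ?_⟩
    have h2 := h1 (T.continuousLinearEquivAt ℝ _ hb w)
    rw [ContinuousLinearEquiv.symm_apply_apply] at h2
    rw [← h2]
    exact (natChart (n := n) x).right_inv (mem_natChart_target hp _)
  exact main _ hproj

theorem natChart_symm_smul {x : M} {p : Phase n} (hp : p ∈ (natChart (n := n) x).target)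
    (c : ℝ) : (natChart (n := n) x).symm (p.1, c • p.2) = scale c ((natChart x).symm p) := by
  obtain ⟨L, hL, -⟩ := exists_fibre_equiv hp
  have h : (natChart x).symm p = ⟨((natChart x).symm p).proj, L.symm p.2⟩ := hL p.2
  rw [hL, map_smul, scale]
  conv_rhs => rw [h]

theorem natChart_symm_mem_slit {x : M} {p : Phase n} (hp : p ∈ (natChart (n := n) x).target) :
    (natChart x).symm p ∈ slit n M ↔ p.2 ≠ 0 := by
  obtain ⟨L, hL, -⟩ := exists_fibre_equiv hp
  have h : (natChart x).symm p = ⟨((natChart x).symm p).proj, L.symm p.2⟩ := hL p.2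
  rw [h, slit, Set.mem_ofPred_eq]
  exact not_congr (map_eq_zero_iff L.symm L.symm.injective)

theorem isOpen_chartDom_slit (x : M) : IsOpen (chartDom (slit n M) x) := by
  have h : chartDom (slit n M) x = (natChart (n := n) x).target ∩ {p : Phase n | p.2 ≠ 0} := by
    ext p
    exact and_congr_right fun hp => natChart_symm_mem_slit hp
  rw [h]
  exact (isOpen_natChart_target x).inter (isOpen_ne_fun continuous_snd continuous_const)

theorem isOpen_chartDom {D : Set (TangentBundle (𝓡 n) M)} (hD : IsOpen D) (x : M) :
    IsOpen (chartDom D x) :=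
  (continuousOn_extChartAt_symm _).isOpen_inter_preimage (isOpen_natChart_target x) hD

theorem contMDiffOn_natChart_symm (x : M) :
    ContMDiffOn 𝓘(ℝ, Phase n) (𝓡 n).tangent ∞ (natChart (n := n) x).symm
      (natChart (n := n) x).target :=
  contMDiffOn_extChartAt_symm _

theorem contDiffOn_chart {F : TangentBundle (𝓡 n) M → ℝ} {D : Set (TangentBundle (𝓡 n) M)}
    (hF : ContMDiffOn (𝓡 n).tangent 𝓘(ℝ, ℝ) ∞ F D) (x : M) :
    ContDiffOn ℝ ∞ (fun p => F ((natChart x).symm p)) (chartDom D x) := by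
  rw [← contMDiffOn_iff_contDiffOn]
  exact hF.comp ((contMDiffOn_natChart_symm x).mono Set.inter_subset_left) fun p hp => hp.2

theorem eulerTwo_chartEnergy {F : TangentBundle (𝓡 n) M → ℝ} {D : Set (TangentBundle (𝓡 n) M)}
    (hF : ContMDiffOn (𝓡 n).tangent 𝓘(ℝ, ℝ) ∞ F D) {x : M} (hD : IsOpen (chartDom D x))
    (hom : ∀ u ∈ D, ∀ c : ℝ, 0 < c → F (scale c u) = c * F u) :
    Local.EulerTwo (chartDom D x) (chartEnergy F x) := fun p hp => by
  refine Local.euler_two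
    ((((contDiffOn_chart hF x).pow 2).div_const 2).contDiffAt (hD.mem_nhds hp)) fun c hc => ?_
  rw [chartEnergy, natChart_symm_smul hp.1, hom _ hp.2 c hc, chartEnergy]
  ring

theorem contDiffOn_chartPi {φ : PiField n M} {D : Set (TangentBundle (𝓡 n) M)}
    (hφ : ContMDiffOn (𝓡 n).tangent (𝓡 n).tangent ∞
      (fun u => (⟨u.proj, φ u⟩ : TangentBundle (𝓡 n) M)) D) (x : M) :
    ContDiffOn ℝ ∞ (chartPi φ x) (chartDom D x) := by
  have h1 := hφ.comp ((contMDiffOn_natChart_symm x).mono Set.inter_subset_left)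
    fun p (hp : p ∈ chartDom D x) => hp.2
  have h2 : ContMDiffOn (𝓡 n).tangent 𝓘(ℝ, Phase n) ∞ (natChart (n := n) x)
      (chartAt (ModelProd (Vec n) (Vec n)) (⟨x, 0⟩ : TangentBundle (𝓡 n) M)).source :=
    contMDiffOn_extChartAt
  -- The domain of a natural chart is a condition on the base point alone, so it contains `φ u`
  -- whenever it contains `u`.
  have h3 := h2.comp h1 fun p hp => by
    have hs : (natChart x).symm p ∈ (natChart (n := n) x).source :=
      (natChart (n := n) x).map_target hp.1
    rw [natChart, extChartAt_source, TangentBundle.mem_chart_source_iff] at hs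
    rw [Set.mem_preimage, TangentBundle.mem_chart_source_iff]
    exact hs
  exact (contMDiffOn_iff_contDiffOn.1 h3).snd

theorem chartPi_ne_zero {φ : PiField n M} {x : M} {p : Phase n}
    (hp : p ∈ (natChart (n := n) x).target) (h : φ ((natChart x).symm p) ≠ 0) :
    chartPi φ x p ≠ 0 := by
  obtain ⟨L, -, hL⟩ := exists_fibre_equiv hp
  rw [chartPi, hL]
  exact (map_ne_zero_iff L L.injective).2 h

/-- The function `g (φ, y)` in a natural chart. -/
theorem assocForm_natChart {F : TangentBundle (𝓡 n) M → ℝ} (hF : IsFinsler F)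
    (φ : PiField n M) {x : M} {p : Phase n} (hp : p ∈ chartDom (slit n M) x) :
    assocForm F φ ((natChart x).symm p) =
      fderiv ℝ (chartEnergy F x) p (0, chartPi φ x p) := by
  have hΩ := isOpen_chartDom_slit (n := n) x
  have he : ContDiffOn ℝ ∞ (chartEnergy F x) (chartDom (slit n M) x) :=
    ((contDiffOn_chart hF.smooth x).pow 2).div_const 2
  have hE := eulerTwo_chartEnergy hF.smooth hΩ fun u _ => hF.homog u
  have hep := he.contDiffAt (hΩ.mem_nhds hp)
  obtain ⟨L, hL, hL'⟩ := exists_fibre_equiv hp.1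
  have h : ((natChart x).symm p).2 = L.symm p.2 := by
    have h0 : (natChart x).symm p = ⟨((natChart x).symm p).proj, L.symm p.2⟩ := hL p.2
    have h1 := hL' ((natChart x).symm p).2
    have h2 : natChart x ((natChart x).symm p) = p := (natChart (n := n) x).right_inv hp.1
    have h3 : (p.1, L ((natChart x).symm p).2) = p := h1.symm.trans h2
    rw [ContinuousLinearEquiv.eq_symm_apply]
    exact congrArg Prod.snd h3
  have hφ : φ ((natChart x).symm p) = L.symm (chartPi φ x p) := by
    rw [chartPi, hL', ContinuousLinearEquiv.symm_apply_apply]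
  have hEn : ∀ s t : ℝ, F (⟨((natChart x).symm p).proj, ((natChart x).symm p).2 +
      s • φ ((natChart x).symm p) + t • ((natChart x).symm p).2⟩ : TangentBundle (𝓡 n) M) ^ 2 / 2 =
        chartEnergy F x ((p + s • (0, chartPi φ x p)) + t • (0, p.2)) := fun s t => by
    have hs : ((p + s • (0, chartPi φ x p)) + t • (0, p.2) : Phase n) =
        (p.1, p.2 + s • chartPi φ x p + t • p.2) := by ext1 <;> simp
    rw [chartEnergy, hs, hL (p.2 + s • chartPi φ x p + t • p.2), h, hφ]
    simp only [map_add, map_smul]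
  rw [assocForm, finslerMetric]
  simp only [hEn]
  rw [Local.deriv_deriv_line hΩ he hp]
  -- This turns `g (φ, y)`, a second derivative of the energy, into its first derivative along `(0,
  -- φ)`.
  have := hE.second hΩ hp hep (0, chartPi φ x p)
  linarith

end Global

theorem mainTheorem3 {n : ℕ} (hn : 2 ≤ n) {M : Type*} [TopologicalSpace M]
    [ChartedSpace (Vec n) M] [IsManifold (𝓡 n) ∞ M] [T2Space M] [ParacompactSpace M] [Nonempty M]
    (F : TangentBundle (𝓡 n) M → ℝ) (hF : IsFinsler F)
    (G : TMField n M) (hG : IsGeodesicSpray (slit n M) F G)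
    (φ : PiField n M) (hφ : IsConcurrent F G φ)
    (hFhat : IsConicPseudoFinsler (matsumotoDomain F φ) (matsumoto F φ))
    (Ghat : TMField n M)
    (hGhat : IsGeodesicSpray (matsumotoDomain F φ) (matsumoto F φ) Ghat) :
    ¬ ProjectivelyRelated (matsumotoDomain F φ) G Ghat := by
  rintro ⟨A, -, hA⟩
  obtain ⟨u, hu⟩ := hFhat.nonempty
  have hΩ := isOpen_chartDom_slit (n := n) u.proj
  have hD := isOpen_chartDom hFhat.isOpen u.proj
  have hDΩ : chartDom (matsumotoDomain F φ) u.proj ⊆ chartDom (slit n M) u.proj :=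
    fun p hp => ⟨hp.1, hp.2.1⟩
  have hsrc : u ∈ (natChart (n := n) u.proj).source := by
    rw [natChart, extChartAt_source, TangentBundle.mem_chart_source_iff]
    exact mem_chart_source _ _
  have hmem : natChart u.proj u ∈ chartDom (matsumotoDomain F φ) u.proj := by
    refine ⟨(natChart (n := n) u.proj).map_source hsrc, ?_⟩
    rw [Set.mem_preimage, (natChart (n := n) u.proj).left_inv hsrc]
    exact hu
  -- A single natural chart, around the base point of some `u` in the conic domain, suffices for the
  -- contradiction.
  refine Local.not_projective hn hΩ (contDiffOn_chart hF.smooth u.proj) (fun p _ => hF.nonneg _)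
    (eulerTwo_chartEnergy hF.smooth hΩ fun u _ => hF.homog u) (hF.maxRank u.proj)
    (fun p hp => (natChart_symm_mem_slit hp.1).1 hp.2) (hG u.proj)
    (contDiffOn_chartPi hφ.smooth u.proj)
    (fun p hp => chartPi_ne_zero hp.1 (hφ.ne_zero _ hp.2)) (hφ.concurrent u.proj) hD hDΩ
    (Φ := fun p => assocForm F φ ((natChart u.proj).symm p))
    (fun p hp => assocForm_natChart hF φ (hDΩ hp)) (fun p hp => hp.2.2)
    (eulerTwo_chartEnergy hFhat.smooth hD hFhat.homog)
    (a := fun p => 2 * A ((natChart u.proj).symm p)) (fun p hp Z => ?_) hmem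
  have h := (hGhat u.proj).2 p hp Z
  rw [hA u.proj p hp] at h
  exact h
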